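/- Let $(\Omega,\mathcal F,(\mathcal F_t)_{t\ge 0},P)$ be a filtered probability space. Let $t_0,t_1,\dots$ be random points of $[0,\infty)$ forming a Poisson point process of intensity $\lambda>0$, and let $a_0,a_1,\dots$ be i.i.d. random variables with values in $\{0,1,2,\dots\}$, independent of $(t_k)_{k\ge0}$, with common probability generating function $g(z)=E[z^{a_0}]$, $|z|\le 1$. Let $$A(t)=\sum_{k\ge 0}a_k\mathbf 1_{\{t_k\le t\}},\qquad t\ge 0,$$ be the corresponding marked Poisson process, and assume that it is adapted to $(\mathcal F_t)$. Let $T$ and $\Delta$ be nonnegative random variables that are independent of each other and such that the pair $(T,\Delta)$ is independent of the filtration, i.e. of $\sigma(\bigcup_{t\ge0}\mathcal F_t)$. Let $u,v,y,w,x,\theta\in\mathbb C$ with $|u|,|v|,|y|\le 1$ and $\operatorname{Re}w,\operatorname{Re}x,\operatorname{Re}\theta\ge 0$. For $t\ge0$ put $$F_1(t)=E\left[u^{A(T)}v^{A(T+\Delta)}e^{-wT-x\Delta}y^{A(t)}\mathbf 1_{\{t<T\}}\right],\qquad F_2(t)=E\left[u^{A(T)}v^{A(T+\Delta)}e^{-wT-x\Delta}y^{A(t)}\mathbf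 1_{\{T\le t<T+\Delta\}}\right],$$ let $F_i^*(\theta)=\int_0^\infty e^{-\theta t}F_i(t)\,dt$ denote their Laplace transforms, and write $L_X(z)=E[e^{-zX}]$ for the Laplace–Stieltjes transform of a nonnegative random variable $X$. If $\operatorname{Re}\theta>0$, then the integrals defining $F_1^*(\theta)$ and $F_2^*(\theta)$ converge absolutely. For every $\theta$ with $\operatorname{Re}\theta\ge0$: 1. if the integral defining $F_1^*(\theta)$ converges absolutely and $\theta+\lambda g(uv)-\lambda g(uvy)\ne0$, then $$F_1^*(\theta)=\frac{L_T(w+\lambda-\lambda g(uv))-L_T(\theta+w+\lambda-\lambda g(uvy))}{\theta+\lambda g(uv)-\lambda g(uvy)}\,L_\Delta(x+\lambda-\lambda g(v));$$ 2. if the integral defining $F_2^*(\theta)$ converges absolutely and $\theta+\lambda g(v)-\lambda g(vy)\ne0$, then $$F_2^*(\theta)=L_T(\theta+w+\lambda-\lambda g(uvy))\,\frac{L_\Delta(x+\lambda-\lambda g(v))-L_\Delta(\theta+x+\lambda-\lambda g(vy))}{\theta+\lambda g(v)-\lambda g(vy)}.$$ -/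

import Mathlib

open MeasureTheory ProbabilityTheory Set
open scoped NNReal ENNReal

noncomputable section

namespace MarkedPoisson

variable {Ω : Type*}

/-- The counting measure `∑ₖ ε_{tₖ}` of a sequence of random points `tₖ ≥ 0`, evaluated at `B`:
the (possibly infinite) number of indices `k` with `tₖ ∈ B`. -/
def pointCount (pt : ℕ → Ω → ℝ≥0) (B : Set ℝ≥0) (ω : Ω) : ℕ∞ :=
  {k : ℕ | pt k ω ∈ B}.encard

/-- Lebesgue measure of a set of nonnegative reals. -/
def length (B : Set ℝ≥0) : ℝ≥0∞ :=
  volume ((fun s : ℝ≥0 => (s : ℝ)) '' B)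

/-- The points `t₀, t₁, …` form a (homogeneous) Poisson point process on `[0, ∞)` of intensity
`lam`: the number of points in a Borel set of finite length is Poisson distributed with mean
`lam` times that length, and the numbers of points in disjoint Borel sets are independent. -/
structure IsPoissonPoints [MeasurableSpace Ω] (P : Measure Ω) (lam : ℝ≥0)
    (pt : ℕ → Ω → ℝ≥0) : Prop where
  measurable : ∀ k, Measurable (pt k)
  map_pointCount : ∀ B : Set ℝ≥0, MeasurableSet B → length B ≠ ∞ →
    P.map (pointCount pt B) =
      (poissonMeasure (lam * (length B).toNNReal)).map (fun n : ℕ => (n : ℕ∞))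
  iIndepFun_pointCount : ∀ (n : ℕ) (B : Fin n → Set ℝ≥0), (∀ i, MeasurableSet (B i)) →
    Pairwise (fun i j => Disjoint (B i) (B j)) → iIndepFun (fun i => pointCount pt (B i)) P

/-- The points `tₖ` and marks `aₖ` form a Poisson process of intensity `lam` with
position-independent marking: the marks are independent, identically distributed, and
independent of the sequence of points. -/
structure IsMarkedPoisson [MeasurableSpace Ω] (P : Measure Ω) (lam : ℝ≥0)
    (pt : ℕ → Ω → ℝ≥0) (mark : ℕ → Ω → ℕ) : Prop where
  isPoissonPoints : IsPoissonPoints P lam pt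
  measurable_mark : ∀ k, Measurable (mark k)
  iIndepFun_mark : iIndepFun mark P
  identDistrib_mark : ∀ k, IdentDistrib (mark k) (mark 0) P P
  indepFun_pt_mark : IndepFun (fun ω k => pt k ω) (fun ω k => mark k ω) P

/-- `A(t) = ∑ₖ aₖ ε_{tₖ}[0, t]`, the total mark of the points in `[0, t]`. -/
def process (pt : ℕ → Ω → ℝ≥0) (mark : ℕ → Ω → ℕ) (t : ℝ≥0) (ω : Ω) : ℕ :=
  ∑' k : ℕ, {s : ℝ≥0 | s ≤ t}.indicator (fun _ => mark k ω) (pt k ω)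

variable [MeasurableSpace Ω]

/-- The probability generating function `E[z ^ X]`. -/
def pgf (P : Measure Ω) (X : Ω → ℕ) (z : ℂ) : ℂ :=
  ∫ ω, z ^ X ω ∂P

/-- The Laplace-Stieltjes transform `L_X(z) = E[exp (-z X)]`. -/
def lst (P : Measure Ω) (X : Ω → ℝ≥0) (z : ℂ) : ℂ :=
  ∫ ω, Complex.exp (-z * ((X ω : ℝ) : ℂ)) ∂P

/-- The functional
`F₁(t) = E[u ^ A(T) v ^ A(T + Δ) exp (-w T - x Δ) y ^ A(t) 1_{t < T}]`. -/
def F₁ (P : Measure Ω) (A : ℝ≥0 → Ω → ℕ) (T Δ : Ω → ℝ≥0) (u v w x y : ℂ) (t : ℝ≥0) : ℂ :=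
  ∫ ω, {ω' | t < T ω'}.indicator (fun ω' =>
    u ^ A (T ω') ω' * v ^ A (T ω' + Δ ω') ω' *
      Complex.exp (-w * ((T ω' : ℝ) : ℂ) - x * ((Δ ω' : ℝ) : ℂ)) * y ^ A t ω') ω ∂P

/-- The functional
`F₂(t) = E[u ^ A(T) v ^ A(T + Δ) exp (-w T - x Δ) y ^ A(t) 1_{T ≤ t < T + Δ}]`. -/
def F₂ (P : Measure Ω) (A : ℝ≥0 → Ω → ℕ) (T Δ : Ω → ℝ≥0) (u v w x y : ℂ) (t : ℝ≥0) : ℂ :=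
  ∫ ω, {ω' | T ω' ≤ t ∧ t < T ω' + Δ ω'}.indicator (fun ω' =>
    u ^ A (T ω') ω' * v ^ A (T ω' + Δ ω') ω' *
      Complex.exp (-w * ((T ω' : ℝ) : ℂ) - x * ((Δ ω' : ℝ) : ℂ)) * y ^ A t ω') ω ∂P

/-- The integrand `exp (-θ t) f(t)` of the Laplace transform, as a function of real `t`
(it is only used for `t ≥ 0`). -/
def laplaceIntegrand (f : ℝ≥0 → ℂ) (θ : ℂ) (t : ℝ) : ℂ :=
  Complex.exp (-θ * (t : ℂ)) * f t.toNNReal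

/-- The Laplace transform integral of `f` at `θ` converges absolutely. -/
def LaplaceConverges (f : ℝ≥0 → ℂ) (θ : ℂ) : Prop :=
  IntegrableOn (laplaceIntegrand f θ) (Ici 0) volume

/-- The Laplace transform `f*(θ) = ∫_{t ≥ 0} exp (-θ t) f(t) dt`. -/
def laplace (f : ℝ≥0 → ℂ) (θ : ℂ) : ℂ :=
  ∫ t in Ici (0 : ℝ), laplaceIntegrand f θ t

end MarkedPoisson

end

/-! Write `q(z) = lam (1 - g z)`. Given `T = a` and `Δ = b`, the quantity under the expectation in
`F₁` or `F₂` involves `A` only at three ordered times: `t < a ≤ a + b` for `F₁`, `a ≤ t < a + b` for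
`F₂`. Independent compound Poisson increments make its mean the exponential of an affine function of
`t`, `a`, `b`. The Laplace transform in `t` over `[0, a)` or `[a, a + b)` is then elementary, and
the result is built from functions of `a` times functions of `b`. Averaging over the independent `T`
and `Δ` gives the stated transforms.

Three points need work. The joint transform at three times (`integral_pow_process`) comes from
integrating out the marks of the first `n` points, which leaves a product of values of a step
function at those points; as `n → ∞` it becomes a product of powers of independent Poisson counts.
Replacing `(T, Δ)` by constants (`integral_process_random_times`) uses right-continuity of the paths
of `A`: evaluation at a random time is a limit of evaluations on countable grids. Finally, Fubini
requires `Re θ > 0`; a boundary point is reached along `θ + 1 / (n + 1)` by dominated convergence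
(`laplace_eq_of_tendsto`). -/

noncomputable section

namespace MarkedPoisson

open Filter Topology

/-! ### Joint transform of the marked Poisson process at three times -/

section MarkedPoissonProcess

/-- The generating function of the Poisson distribution. -/
lemma integral_pow_poissonMeasure (r : ℝ≥0) (c : ℂ) :
    ∫ n : ℕ, c ^ n ∂(poissonMeasure r) = Complex.exp (-(r : ℂ) * (1 - c)) := by
  rw [integral_poissonMeasure]
  have h := NormedSpace.expSeries_div_hasSum_exp ((r : ℂ) * c)
  rw [← Complex.exp_eq_exp_ℂ] at h
  have h2 := (h.mul_left (Complex.exp (-(r : ℂ)))).tsum_eq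
  rw [← Complex.exp_add] at h2
  rw [show -(r : ℂ) * (1 - c) = -(r : ℂ) + r * c by ring, ← h2]
  refine tsum_congr fun n => ?_
  rw [Complex.real_smul]
  push_cast
  rw [mul_pow]
  ring

lemma length_Iic (t : ℝ≥0) : length (Iic t) = t := by
  have : (fun s : ℝ≥0 => (s : ℝ)) '' (Iic t) = Icc 0 (t : ℝ) := by
    ext r
    constructor
    · rintro ⟨s, hs, rfl⟩
      exact ⟨s.2, hs⟩
    · rintro ⟨h0, h1⟩
      exact ⟨⟨r, h0⟩, h1, rfl⟩
  rw [length, this, Real.volume_Icc]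
  simp

lemma length_Ioc (s t : ℝ≥0) : length (Ioc s t) = (t - s : ℝ≥0) := by
  have : (fun s : ℝ≥0 => (s : ℝ)) '' (Ioc s t) = Ioc (s : ℝ) (t : ℝ) := by
    ext r
    constructor
    · rintro ⟨s, hs, rfl⟩
      exact ⟨hs.1, hs.2⟩
    · rintro ⟨h0, h1⟩
      exact ⟨⟨r, s.2.trans h0.le⟩, ⟨h0, h1⟩, rfl⟩
  rw [length, this, Real.volume_Ioc]
  rw [ENNReal.ofReal_sub _ (NNReal.coe_nonneg s)]
  simp

variable {Ω : Type*}

/-- The prefixes of a product along a sequence of points which are finitely many in `B` count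
the points of `B`. -/
lemma eventually_pow_pointCount (pt : ℕ → Ω → ℝ≥0) (B : Set ℝ≥0) [DecidablePred (· ∈ B)] (ω : Ω)
    (hfin : {k | pt k ω ∈ B}.Finite) (G : ℂ) :
    ∀ᶠ n in atTop, ∏ k ∈ Finset.range n, (if pt k ω ∈ B then G else 1) =
      G ^ (pointCount pt B ω).toNat := by
  obtain ⟨N, hN⟩ := hfin.bddAbove
  filter_upwards [eventually_gt_atTop N] with n hn
  rw [← Finset.prod_filter, Finset.prod_const]
  have : {k | pt k ω ∈ B} = ((Finset.range n).filter fun k => pt k ω ∈ B : Finset ℕ) := by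
    ext k
    simp only [mem_ofPred_eq, Finset.coe_filter, Finset.mem_range]
    exact ⟨fun h => ⟨(hN h).trans_lt hn, h⟩, fun h => h.2⟩
  rw [pointCount, this, encard_coe_eq_coe_finsetCard, ENat.toNat_natCast]

lemma eventually_process_eq (pt : ℕ → Ω → ℝ≥0) (mark : ℕ → Ω → ℕ) (t : ℝ≥0) (ω : Ω)
    (hfin : {k | pt k ω ≤ t}.Finite) :
    ∀ᶠ n in atTop, process pt mark t ω =
      ∑ k ∈ Finset.range n, if pt k ω ≤ t then mark k ω else 0 := by
  classical
  obtain ⟨N, hN⟩ := hfin.bddAbove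
  filter_upwards [eventually_gt_atTop N] with n hn
  rw [process, tsum_eq_sum (s := Finset.range n)]
  · simp [indicator_apply]
  · intro k hk
    refine indicator_of_notMem (fun h => hk ?_) _
    exact Finset.mem_range.2 ((hN h).trans_lt hn)

lemma eventually_pow_process (pt : ℕ → Ω → ℝ≥0) (mark : ℕ → Ω → ℕ) (t : ℝ≥0) (ω : Ω)
    (hfin : {k | pt k ω ≤ t}.Finite) (z : ℂ) :
    ∀ᶠ n in atTop, ∏ k ∈ Finset.range n, (if pt k ω ≤ t then z else 1) ^ mark k ω =
      z ^ process pt mark t ω := by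
  filter_upwards [eventually_process_eq pt mark t ω hfin] with n hn
  rw [hn, ← Finset.prod_pow_eq_pow_sum]
  refine Finset.prod_congr rfl fun k _ => ?_
  split_ifs <;> simp

variable [MeasurableSpace Ω] {P : Measure Ω}

lemma norm_pgf_le [IsProbabilityMeasure P] (X : Ω → ℕ) {z : ℂ} (hz : ‖z‖ ≤ 1) :
    ‖pgf P X z‖ ≤ 1 := by
  have := norm_integral_le_of_norm_le_const (μ := P) (f := fun ω => z ^ X ω) (C := 1)
    (Eventually.of_forall fun ω => by
      rw [norm_pow]; exact pow_le_one₀ (norm_nonneg _) hz)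
  simpa [pgf] using this

@[simp] lemma pgf_one [IsProbabilityMeasure P] (X : Ω → ℕ) : pgf P X 1 = 1 := by
  simp [pgf]

variable {lam : ℝ≥0} {pt : ℕ → Ω → ℝ≥0} {mark : ℕ → Ω → ℕ}

lemma measurable_pgf [IsProbabilityMeasure P] {X : Ω → ℕ} (hX : Measurable X) : Measurable (pgf P X) := by
  have h1 : Measurable fun q : ℂ × ℕ => q.1 ^ q.2 :=
    measurable_from_prod_countable_left fun y => by fun_prop
  have h2 : Measurable fun q : ℂ × Ω => q.1 ^ X q.2 :=
    h1.comp (f := fun q : ℂ × Ω => (q.1, X q.2)) (by fun_prop)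
  exact (StronglyMeasurable.integral_prod_right (ν := P) (f := fun z ω => z ^ X ω)
    h2.stronglyMeasurable).measurable

/-- Freezing lemma: one of two independent variables can be integrated out first. -/
lemma integral_comp_prodMk_of_indepFun {S S' : Type*} [MeasurableSpace S] [MeasurableSpace S']
    [IsProbabilityMeasure P] {X : Ω → S} {Y : Ω → S'} (hX : Measurable X) (hY : Measurable Y)
    (hXY : IndepFun X Y P) {Φ : S × S' → ℂ} (hΦ : Measurable Φ) (hΦ1 : ∀ q, ‖Φ q‖ ≤ 1) :
    ∫ ω, Φ (X ω, Y ω) ∂P = ∫ p, ∫ ω, Φ (p, Y ω) ∂P ∂(P.map X) := by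
  have hlaw := (indepFun_iff_map_prod_eq_prod_map_map hX.aemeasurable hY.aemeasurable).1 hXY
  have : IsProbabilityMeasure (P.map X) := Measure.isProbabilityMeasure_map hX.aemeasurable
  have : IsProbabilityMeasure (P.map Y) := Measure.isProbabilityMeasure_map hY.aemeasurable
  have hint : Integrable Φ ((P.map X).prod (P.map Y)) :=
    .of_bound hΦ.aestronglyMeasurable 1 (Eventually.of_forall hΦ1)
  rw [← integral_map (φ := fun ω => (X ω, Y ω)) (hX.prodMk hY).aemeasurable
    hΦ.aestronglyMeasurable, hlaw, integral_prod _ hint]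
  refine integral_congr_ae (Eventually.of_forall fun p => ?_)
  exact integral_map (f := fun y => Φ (p, y)) hY.aemeasurable
    (hΦ.comp measurable_prodMk_left).aestronglyMeasurable

namespace IsPoissonPoints

/-- The prescribed law forces this: `Measure.map` along a map that is not a.e. measurable is the
zero measure, which is not a Poisson law. -/
lemma aemeasurable_pointCount (h : IsPoissonPoints P lam pt) {B : Set ℝ≥0}
    (hB : MeasurableSet B) (hlen : length B ≠ ∞) : AEMeasurable (pointCount pt B) P := by
  by_contra hm
  have h1 := h.map_pointCount B hB hlen
  rw [Measure.map_of_not_aemeasurable hm] at h1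
  have h2 : IsProbabilityMeasure
      ((poissonMeasure (lam * (length B).toNNReal)).map (fun n : ℕ => (n : ℕ∞))) :=
    Measure.isProbabilityMeasure_map (by fun_prop)
  rw [← h1] at h2
  exact h2.ne_zero _ rfl

/-- A Poisson count is finite, and countably many intervals `[0, N]` suffice to treat all `t`
outside one null set. There the series defining `process` is a finite sum, so the default value of
`∑'` plays no role. -/
lemma ae_finite (h : IsPoissonPoints P lam pt) :
    ∀ᵐ ω ∂P, ∀ t, {k | pt k ω ≤ t}.Finite := by
  have key : ∀ N : ℕ, ∀ᵐ ω ∂P, {k | pt k ω ≤ N}.Finite := by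
    intro N
    have hl : length (Iic (N : ℝ≥0)) ≠ ∞ := by simp [length_Iic]
    have hm := h.aemeasurable_pointCount measurableSet_Iic hl
    have h1 : ∀ᵐ n ∂(P.map (pointCount pt (Iic (N : ℝ≥0)))), n ≠ ⊤ := by
      rw [h.map_pointCount _ measurableSet_Iic hl, ae_map_iff (by fun_prop)
        (MeasurableSet.of_discrete)]
      exact Eventually.of_forall fun n => ENat.natCast_ne_top n
    filter_upwards [ae_of_ae_map hm h1] with ω hω
    exact encard_ne_top_iff.1 hω
  filter_upwards [ae_all_iff.2 key] with ω hω t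
  obtain ⟨N, hN⟩ := exists_nat_ge t
  exact (hω N).subset fun k hk => le_trans hk hN

lemma integral_pow_pointCount (h : IsPoissonPoints P lam pt) {B : Set ℝ≥0}
    (hB : MeasurableSet B) (hlen : length B ≠ ∞) (G : ℂ) :
    ∫ ω, G ^ (pointCount pt B ω).toNat ∂P =
      Complex.exp (-(lam * (length B).toNNReal : ℝ≥0) * (1 - G)) := by
  rw [← integral_map (f := fun n : ℕ∞ => G ^ n.toNat) (h.aemeasurable_pointCount hB hlen)
    (measurable_of_countable _).aestronglyMeasurable, h.map_pointCount B hB hlen,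
    integral_map (by fun_prop) (measurable_of_countable _).aestronglyMeasurable]
  simp only [ENat.toNat_natCast]
  exact integral_pow_poissonMeasure _ _

end IsPoissonPoints

namespace IsMarkedPoisson

variable [IsProbabilityMeasure P]

/-- Integrating out the marks at finitely many of the points. -/
lemma integral_prod_pow_mark (h : IsMarkedPoisson P lam pt mark) {c : ℝ≥0 → ℂ}
    (hc : Measurable c) (hc1 : ∀ s, ‖c s‖ ≤ 1) (n : ℕ) :
    ∫ ω, ∏ k ∈ Finset.range n, c (pt k ω) ^ mark k ω ∂P =
      ∫ ω, ∏ k ∈ Finset.range n, pgf P (mark 0) (c (pt k ω)) ∂P := by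
  have hpt : Measurable fun ω k => pt k ω := measurable_pi_lambda _ h.isPoissonPoints.measurable
  have hmk : Measurable fun ω k => mark k ω := measurable_pi_lambda _ h.measurable_mark
  let Φ : (ℕ → ℝ≥0) × (ℕ → ℕ) → ℂ := fun q => ∏ k ∈ Finset.range n, c (q.1 k) ^ q.2 k
  have hΦ : Measurable Φ := by
    refine Finset.measurable_prod _ fun k _ => ?_
    have : Measurable fun q : ℂ × ℕ => q.1 ^ q.2 :=
      measurable_from_prod_countable_left fun y => by fun_prop
    exact this.comp (f := fun q : (ℕ → ℝ≥0) × (ℕ → ℕ) => (c (q.1 k), q.2 k)) (by fun_prop)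
  have hΦ1 : ∀ q, ‖Φ q‖ ≤ 1 := fun q => by
    rw [norm_prod]
    refine Finset.prod_le_one (fun _ _ => norm_nonneg _) fun k _ => ?_
    rw [norm_pow]
    exact pow_le_one₀ (norm_nonneg _) (hc1 _)
  rw [integral_comp_prodMk_of_indepFun (Φ := Φ) hpt hmk h.indepFun_pt_mark hΦ hΦ1,
    ← integral_map (f := fun p : ℕ → ℝ≥0 => ∏ k ∈ Finset.range n, pgf P (mark 0) (c (p k)))
      hpt.aemeasurable]
  swap
  · refine (Finset.measurable_prod _ fun k _ => ?_).aestronglyMeasurable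
    exact (measurable_pgf (h.measurable_mark 0)).comp (hc.comp (measurable_pi_apply k))
  refine integral_congr_ae (Eventually.of_forall fun p => ?_)
  -- With the points frozen at `p`, the factors are functions of distinct marks, hence independent.
  have hind : iIndepFun (fun k : Fin n => fun ω => c (p k) ^ mark k ω) P :=
    (h.iIndepFun_mark.precomp (g := fun k : Fin n => (k : ℕ)) Fin.val_injective).comp
      (fun k m => c (p k) ^ m) fun k => measurable_of_countable _
  have := hind.integral_fun_prod_eq_prod_integral fun k =>
    ((measurable_of_countable fun m : ℕ => c (p k) ^ m).comp
      (h.measurable_mark k)).aestronglyMeasurable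
  simp only [Φ]
  simp_rw [Finset.prod_range]
  rw [this]
  refine Finset.prod_congr rfl fun k _ => ?_
  exact ((h.identDistrib_mark k).comp
    (measurable_of_countable fun m : ℕ => c (p k) ^ m)).integral_eq

/-- The joint transform of the process at three ordered times. -/
lemma integral_pow_process (h : IsMarkedPoisson P lam pt mark) {s₁ s₂ s₃ : ℝ≥0}
    (h₁₂ : s₁ ≤ s₂) (h₂₃ : s₂ ≤ s₃) {z₁ z₂ z₃ : ℂ} (hz₁ : ‖z₁‖ ≤ 1) (hz₂ : ‖z₂‖ ≤ 1)
    (hz₃ : ‖z₃‖ ≤ 1) :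
    ∫ ω, z₁ ^ process pt mark s₁ ω * z₂ ^ process pt mark s₂ ω * z₃ ^ process pt mark s₃ ω ∂P =
      Complex.exp (-(lam * (1 - pgf P (mark 0) (z₁ * z₂ * z₃))) * (s₁ : ℝ)
        - (lam * (1 - pgf P (mark 0) (z₂ * z₃))) * ((s₂ : ℝ) - (s₁ : ℝ))
        - (lam * (1 - pgf P (mark 0) z₃)) * ((s₃ : ℝ) - (s₂ : ℝ))) := by
  have hP := h.isPoissonPoints
  set G := pgf P (mark 0) with hG
  -- A point at `r` with mark `m` contributes `c r ^ m` to the product of the three powers, since it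
  -- is counted at exactly those times `sᵢ ≥ r`.
  let c : ℝ≥0 → ℂ := fun r =>
    (if r ≤ s₁ then z₁ else 1) * (if r ≤ s₂ then z₂ else 1) * (if r ≤ s₃ then z₃ else 1)
  have hite : ∀ (r s : ℝ≥0) {z : ℂ}, ‖z‖ ≤ 1 → ‖if r ≤ s then z else 1‖ ≤ 1 := by
    intro r s z hz
    split_ifs
    · exact hz
    · simp
  have hm : ∀ (s : ℝ≥0) (z : ℂ), Measurable fun r : ℝ≥0 => if r ≤ s then z else 1 :=
    fun s z => Measurable.ite measurableSet_Iic measurable_const measurable_const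
  have hc : Measurable c := ((hm _ _).mul (hm _ _)).mul (hm _ _)
  have hmul : ∀ {a b : ℂ}, ‖a‖ ≤ 1 → ‖b‖ ≤ 1 → ‖a * b‖ ≤ 1 := fun ha hb => by
    rw [norm_mul]; exact mul_le_one₀ ha (norm_nonneg _) hb
  have hc1 : ∀ r, ‖c r‖ ≤ 1 := fun r =>
    hmul (hmul (hite _ _ hz₁) (hite _ _ hz₂)) (hite _ _ hz₃)
  have hprod : ∀ (f : ℕ → ℂ) (n : ℕ), (∀ k, ‖f k‖ ≤ 1) → ‖∏ k ∈ Finset.range n, f k‖ ≤ 1 := by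
    intro f n hf
    rw [norm_prod]
    exact Finset.prod_le_one (fun _ _ => norm_nonneg _) fun k _ => hf k
  have hpowm : Measurable fun q : ℂ × ℕ => q.1 ^ q.2 :=
    measurable_from_prod_countable_left fun y => by fun_prop
  -- limit of the left-hand sides
  have hL : Tendsto (fun n => ∫ ω, ∏ k ∈ Finset.range n, c (pt k ω) ^ mark k ω ∂P) atTop
      (𝓝 (∫ ω, z₁ ^ process pt mark s₁ ω * z₂ ^ process pt mark s₂ ω *
        z₃ ^ process pt mark s₃ ω ∂P)) := by
    refine tendsto_integral_of_dominated_convergence (fun _ => 1) ?_ (integrable_const _) ?_ ?_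
    · intro n
      refine (Finset.measurable_prod _ fun k _ => ?_).aestronglyMeasurable
      exact hpowm.comp (f := fun ω => (c (pt k ω), mark k ω))
        ((hc.comp (hP.measurable k)).prodMk (h.measurable_mark k))
    · intro n
      refine Eventually.of_forall fun ω => hprod _ _ fun k => ?_
      rw [norm_pow]
      exact pow_le_one₀ (norm_nonneg _) (hc1 _)
    · filter_upwards [hP.ae_finite] with ω hω
      refine tendsto_const_nhds.congr' ?_
      filter_upwards [eventually_pow_process pt mark s₁ ω (hω _) z₁,
        eventually_pow_process pt mark s₂ ω (hω _) z₂,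
        eventually_pow_process pt mark s₃ ω (hω _) z₃] with n h1 h2 h3
      rw [← h1, ← h2, ← h3, ← Finset.prod_mul_distrib, ← Finset.prod_mul_distrib]
      exact Finset.prod_congr rfl fun k _ => by simp only [c, mul_pow]
  -- limit of the right-hand sides
  let D : Fin 3 → Set ℝ≥0 := ![Iic s₁, Ioc s₁ s₂, Ioc s₂ s₃]
  -- The values of `G ∘ c` on the three intervals of `D`. Beyond `s₃` the value is `G 1 = 1`, so
  -- later points contribute nothing.
  let Z : Fin 3 → ℂ := ![G (z₁ * z₂ * z₃), G (z₂ * z₃), G z₃]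
  have hD : ∀ i, MeasurableSet (D i) := by
    intro i; fin_cases i
    · exact measurableSet_Iic
    · exact measurableSet_Ioc
    · exact measurableSet_Ioc
  have hDl : ∀ i, length (D i) ≠ ∞ := by
    intro i; fin_cases i <;> simp [D, length_Iic, length_Ioc]
  have hDs : ∀ i, D i ⊆ Iic s₃ := by
    intro i; fin_cases i
    · exact Iic_subset_Iic.2 (h₁₂.trans h₂₃)
    · exact fun r hr => hr.2.trans h₂₃
    · exact fun r hr => hr.2
  have hdisj : Pairwise fun i j => Disjoint (D i) (D j) := by
    have h01 : Disjoint (Iic s₁) (Ioc s₁ s₂) :=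
      Set.disjoint_left.2 fun r hr hr' => (lt_of_lt_of_le hr'.1 hr).false
    have h02 : Disjoint (Iic s₁) (Ioc s₂ s₃) :=
      Set.disjoint_left.2 fun r hr hr' => (h₁₂.trans_lt (lt_of_lt_of_le hr'.1 hr)).false
    have h12 : Disjoint (Ioc s₁ s₂) (Ioc s₂ s₃) :=
      Set.disjoint_left.2 fun r hr hr' => (lt_of_lt_of_le hr'.1 hr.2).false
    intro i j hij
    fin_cases i <;> fin_cases j <;> first
      | exact absurd rfl hij
      | exact h01
      | exact h02
      | exact h12
      | exact h01.symm
      | exact h02.symm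
      | exact h12.symm
  classical
  have hGc : ∀ r, G (c r) = ∏ i, if r ∈ D i then Z i else 1 := by
    intro r
    simp only [Fin.prod_univ_three, D, Z, c, Matrix.cons_val_zero, Matrix.cons_val_one,
      Matrix.cons_val, mem_Iic, mem_Ioc]
    by_cases h1 : r ≤ s₁
    · have h2 := h1.trans h₁₂
      simp [h1, h2, h2.trans h₂₃, not_lt.2 h1, not_lt.2 h2]
    · by_cases h2 : r ≤ s₂
      · simp [h1, h2, h2.trans h₂₃, not_lt.2 h2, not_le.1 h1]
      · by_cases h3 : r ≤ s₃
        · simp [h1, h2, h3, not_le.1 h2]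
        · simp [h1, h2, h3, hG]
  have hR : Tendsto (fun n => ∫ ω, ∏ k ∈ Finset.range n, G (c (pt k ω)) ∂P) atTop
      (𝓝 (∫ ω, ∏ i, Z i ^ (pointCount pt (D i) ω).toNat ∂P)) := by
    refine tendsto_integral_of_dominated_convergence (fun _ => 1) ?_ (integrable_const _) ?_ ?_
    · intro n
      refine (Finset.measurable_prod _ fun k _ => ?_).aestronglyMeasurable
      exact (measurable_pgf (h.measurable_mark 0)).comp (hc.comp (hP.measurable k))
    · intro n
      exact Eventually.of_forall fun ω => hprod _ _ fun k => norm_pgf_le _ (hc1 _)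
    · filter_upwards [hP.ae_finite] with ω hω
      refine tendsto_const_nhds.congr' ?_
      filter_upwards [eventually_all.2 fun i => eventually_pow_pointCount pt (D i) ω
        ((hω s₃).subset fun k hk => hDs i hk) (Z i)] with n hn
      simp_rw [hGc]
      rw [Finset.prod_comm]
      exact (Finset.prod_congr rfl fun i _ => hn i).symm
  -- Integrating out the marks identifies the two sequences, hence their limits.
  simp_rw [integral_prod_pow_mark h hc hc1] at hL
  rw [tendsto_nhds_unique hL hR]
  have hind := (hP.iIndepFun_pointCount 3 D hD hdisj).comp (fun i m => Z i ^ m.toNat)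
    fun i => measurable_of_countable _
  have hfac := hind.integral_fun_prod_eq_prod_integral fun i =>
    ((measurable_of_countable fun m : ℕ∞ => Z i ^ m.toNat).comp_aemeasurable
      (hP.aemeasurable_pointCount (hD i) (hDl i))).aestronglyMeasurable
  simp only [Function.comp_apply] at hfac
  rw [hfac]
  simp_rw [hP.integral_pow_pointCount (hD _) (hDl _)]
  simp only [Fin.prod_univ_three, D, Z, Matrix.cons_val_zero, Matrix.cons_val_one,
    Matrix.cons_val, length_Iic, length_Ioc, ENNReal.toNNReal_coe]
  rw [← Complex.exp_add, ← Complex.exp_add]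
  congr 1
  push_cast [NNReal.coe_sub h₁₂, NNReal.coe_sub h₂₃]
  ring

end IsMarkedPoisson

end MarkedPoissonProcess

/-! ### Freezing the independent random times -/

section RandomTimes

variable {Ω : Type*}

/-- Only finitely many points lie in `(t, t + 1]`, so `s n` eventually falls short of all of them.
-/
lemma eventually_process_eq_of_tendsto_right (pt : ℕ → Ω → ℝ≥0) (mark : ℕ → Ω → ℕ) (t : ℝ≥0)
    (ω : Ω) (hfin : {k | pt k ω ≤ t + 1}.Finite) {s : ℕ → ℝ≥0} (hs : Tendsto s atTop (𝓝 t))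
    (hts : ∀ n, t ≤ s n) :
    ∀ᶠ n in atTop, process pt mark (s n) ω = process pt mark t ω := by
  have h1 : ∀ᶠ n in atTop, s n < t + 1 := hs.eventually_lt_const (lt_add_one t)
  have h2 : ∀ᶠ n in atTop, ∀ k ∈ {k | pt k ω ≤ t + 1}, t < pt k ω → s n < pt k ω :=
    (eventually_all_finite hfin).2 fun k _ => by
      by_cases hk : t < pt k ω
      · filter_upwards [hs.eventually_lt_const hk] with n hn _ using hn
      · exact Eventually.of_forall fun n h => absurd h hk
  filter_upwards [h1, h2] with n hn1 hn2
  refine tsum_congr fun k => ?_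
  have : pt k ω ≤ s n ↔ pt k ω ≤ t := by
    refine ⟨fun h => ?_, fun h => h.trans (hts n)⟩
    by_contra hk
    exact (hn2 k (h.trans hn1.le) (not_le.1 hk)).not_ge h
  simp only [indicator_apply, mem_ofPred_eq, this]

/-- The smallest multiple of `1 / (n + 1)` that exceeds `t`. -/
def gridAbove (n : ℕ) (t : ℝ≥0) : ℝ≥0 := ((⌊t * (n + 1)⌋₊ : ℝ≥0) + 1) / (n + 1)

lemma le_gridAbove (n : ℕ) (t : ℝ≥0) : t ≤ gridAbove n t := by
  rw [gridAbove, le_div_iff₀ (by positivity)]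
  exact (Nat.lt_floor_add_one _).le

lemma gridAbove_le (n : ℕ) (t : ℝ≥0) : gridAbove n t ≤ t + 1 / (n + 1) := by
  rw [gridAbove, add_div]
  gcongr
  rw [div_le_iff₀ (by positivity)]
  exact Nat.floor_le (by positivity)

lemma tendsto_gridAbove (t : ℝ≥0) : Tendsto (fun n => gridAbove n t) atTop (𝓝 t) := by
  refine tendsto_of_tendsto_of_tendsto_of_le_of_le tendsto_const_nhds ?_
    (fun n => le_gridAbove n t) (fun n => gridAbove_le n t)
  have h : Tendsto (fun n : ℕ => (1 : ℝ≥0) / (n + 1)) atTop (𝓝 0) :=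
    tendsto_one_div_add_atTop_nhds_zero_nat
  simpa using tendsto_const_nhds.add h

/-- Evaluation at a variable time is not jointly measurable on the full product space of paths; on
the grid only countably many coordinates occur. -/
lemma measurable_eval_gridAbove (n : ℕ) :
    Measurable fun q : ℝ≥0 × (ℝ≥0 → ℕ) => q.2 (gridAbove n q.1) := by
  have h1 : Measurable fun q : ℕ × (ℝ≥0 → ℕ) => q.2 (((q.1 : ℝ≥0) + 1) / (n + 1)) :=
    measurable_from_prod_countable_right fun N =>
      measurable_pi_apply (X := fun _ : ℝ≥0 => ℕ) (((N : ℝ≥0) + 1) / (n + 1))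
  exact h1.comp (f := fun q : ℝ≥0 × (ℝ≥0 → ℕ) => (⌊q.1 * (n + 1)⌋₊, q.2)) (by fun_prop)

lemma norm_pow_mul_le {z c : ℂ} (hz : ‖z‖ ≤ 1) (hc : ‖c‖ ≤ 1) (n : ℕ) : ‖c * z ^ n‖ ≤ 1 := by
  rw [norm_mul, norm_pow]
  exact mul_le_one₀ hc (by positivity) (pow_le_one₀ (norm_nonneg _) hz)

variable [mΩ : MeasurableSpace Ω] {P : Measure Ω} [IsProbabilityMeasure P]
  {lam : ℝ≥0} {pt : ℕ → Ω → ℝ≥0} {mark : ℕ → Ω → ℕ}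

/-- Random times independent of the process can be frozen inside an expectation. -/
lemma integral_process_random_times (hP : IsPoissonPoints P lam pt)
    (ℱ : Filtration ℝ≥0 mΩ) (hadapted : Adapted ℱ (process pt mark))
    {T Δ : Ω → ℝ≥0} (hT : Measurable T) (hΔ : Measurable Δ)
    (hTΔℱ : Indep (MeasurableSpace.comap (fun ω => (T ω, Δ ω)) inferInstance) (⨆ t, ℱ t) P)
    {u v y : ℂ} (hu : ‖u‖ ≤ 1) (hv : ‖v‖ ≤ 1) (hy : ‖y‖ ≤ 1) (t : ℝ≥0)
    {φ : ℝ≥0 × ℝ≥0 → ℂ} (hφ : Measurable φ) (hφ1 : ∀ p, ‖φ p‖ ≤ 1) :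
    ∫ ω, φ (T ω, Δ ω) * u ^ process pt mark (T ω) ω * v ^ process pt mark (T ω + Δ ω) ω *
        y ^ process pt mark t ω ∂P =
      ∫ p : ℝ≥0 × ℝ≥0, ∫ ω, φ p * u ^ process pt mark p.1 ω *
        v ^ process pt mark (p.1 + p.2) ω * y ^ process pt mark t ω ∂P
        ∂(P.map fun ω => (T ω, Δ ω)) := by
  set A := process pt mark with hA
  have hX : Measurable fun ω => (T ω, Δ ω) := hT.prodMk hΔ
  have hAm : ∀ s, Measurable (A s) := fun s => (hadapted s).mono (ℱ.le s) le_rfl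
  have hY : Measurable fun ω s => A s ω := measurable_pi_lambda _ hAm
  have hXY : IndepFun (fun ω => (T ω, Δ ω)) (fun ω s => A s ω) P := by
    refine indep_of_indep_of_le_right hTΔℱ ?_
    have : Measurable[⨆ t, ℱ t] fun ω s => A s ω :=
      @measurable_pi_lambda Ω ℝ≥0 (fun _ => ℕ) (⨆ t, ℱ t) _ _ fun s =>
        (hadapted s).mono (le_iSup (fun t => (ℱ t : MeasurableSpace Ω)) s) le_rfl
    exact this.comap_le
  have : IsProbabilityMeasure (P.map fun ω => (T ω, Δ ω)) :=
    Measure.isProbabilityMeasure_map hX.aemeasurable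
  let Φ : ℕ → (ℝ≥0 × ℝ≥0) × (ℝ≥0 → ℕ) → ℂ := fun n q =>
    φ q.1 * u ^ q.2 (gridAbove n q.1.1) * v ^ q.2 (gridAbove n (q.1.1 + q.1.2)) * y ^ q.2 t
  have hpow : ∀ z : ℂ, Measurable fun m : ℕ => z ^ m := fun z => measurable_of_countable _
  have hΦ : ∀ n, Measurable (Φ n) := fun n =>
    (((hφ.comp measurable_fst).mul ((hpow u).comp ((measurable_eval_gridAbove n).comp
      (f := fun q : (ℝ≥0 × ℝ≥0) × (ℝ≥0 → ℕ) => (q.1.1, q.2)) (by fun_prop)))).mul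
      ((hpow v).comp ((measurable_eval_gridAbove n).comp
      (f := fun q : (ℝ≥0 × ℝ≥0) × (ℝ≥0 → ℕ) => (q.1.1 + q.1.2, q.2)) (by fun_prop)))).mul
      ((hpow y).comp ((measurable_pi_apply t).comp measurable_snd))
  have hΦ1 : ∀ n q, ‖Φ n q‖ ≤ 1 := fun n q =>
    norm_pow_mul_le hy (norm_pow_mul_le hv (norm_pow_mul_le hu (hφ1 _) _) _) _
  -- The null set does not depend on `p`, so the limit applies both at the random `(T ω, Δ ω)` and
  -- at a frozen pair.
  have hlim : ∀ᵐ ω ∂P, ∀ p : ℝ≥0 × ℝ≥0, Tendsto (fun n => Φ n (p, fun s => A s ω)) atTop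
      (𝓝 (φ p * u ^ A p.1 ω * v ^ A (p.1 + p.2) ω * y ^ A t ω)) := by
    filter_upwards [hP.ae_finite] with ω hω p
    refine tendsto_const_nhds.congr' ?_
    filter_upwards [eventually_process_eq_of_tendsto_right pt mark p.1 ω (hω _)
        (tendsto_gridAbove _) (fun n => le_gridAbove n _),
      eventually_process_eq_of_tendsto_right pt mark (p.1 + p.2) ω (hω _)
        (tendsto_gridAbove _) (fun n => le_gridAbove n _)] with n h1 h2
    simp only [Φ, hA, h1, h2]
  have hL : Tendsto (fun n => ∫ ω, Φ n ((T ω, Δ ω), fun s => A s ω) ∂P) atTop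
      (𝓝 (∫ ω, φ (T ω, Δ ω) * u ^ A (T ω) ω * v ^ A (T ω + Δ ω) ω * y ^ A t ω ∂P)) := by
    refine tendsto_integral_of_dominated_convergence (fun _ => 1)
      (fun n => ((hΦ n).comp (hX.prodMk hY)).aestronglyMeasurable) (integrable_const _)
      (fun n => Eventually.of_forall fun ω => hΦ1 n _) ?_
    filter_upwards [hlim] with ω hω using hω _
  have hR : Tendsto (fun n => ∫ p, ∫ ω, Φ n (p, fun s => A s ω) ∂P ∂(P.map fun ω => (T ω, Δ ω)))
      atTop (𝓝 (∫ p : ℝ≥0 × ℝ≥0, ∫ ω, φ p * u ^ A p.1 ω * v ^ A (p.1 + p.2) ω * y ^ A t ω ∂P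
        ∂(P.map fun ω => (T ω, Δ ω)))) := by
    refine tendsto_integral_of_dominated_convergence (fun _ => 1)
      (fun n => ?_) (integrable_const _) (fun n => Eventually.of_forall fun p => ?_)
      (Eventually.of_forall fun p => ?_)
    · have : Measurable fun q : (ℝ≥0 × ℝ≥0) × Ω => Φ n (q.1, fun s => A s q.2) :=
        (hΦ n).comp (measurable_fst.prodMk (hY.comp measurable_snd))
      exact (StronglyMeasurable.integral_prod_right (ν := P)
        (f := fun p ω => Φ n (p, fun s => A s ω)) this.stronglyMeasurable).aestronglyMeasurable
    · simpa using norm_integral_le_of_norm_le_const (μ := P)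
        (Eventually.of_forall fun ω => hΦ1 n (p, fun s => A s ω))
    · refine tendsto_integral_of_dominated_convergence (fun _ => 1)
        (fun n => ((hΦ n).comp (measurable_const.prodMk hY)).aestronglyMeasurable)
        (integrable_const _) (fun n => Eventually.of_forall fun ω => hΦ1 n _) ?_
      filter_upwards [hlim] with ω hω using hω _
  refine tendsto_nhds_unique hL (hR.congr fun n => ?_)
  exact (integral_comp_prodMk_of_indepFun hX hY hXY (hΦ n) (hΦ1 n)).symm

end RandomTimes

/-! ### Laplace transforms: boundary limits, mixtures, truncated exponentials -/

section LaplaceTransforms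

lemma tendsto_add_one_div (z : ℂ) :
    Tendsto (fun n : ℕ => z + ((1 / ((n : ℝ) + 1) : ℝ) : ℂ)) atTop (𝓝 z) := by
  simpa using tendsto_const_nhds.add
    ((Complex.continuous_ofReal.tendsto 0).comp tendsto_one_div_add_atTop_nhds_zero_nat)

lemma norm_exp_neg_mul_le {z : ℂ} (hz : 0 ≤ z.re) {t : ℝ} (ht : 0 ≤ t) :
    ‖Complex.exp (-z * t)‖ ≤ 1 := by
  rw [Complex.norm_exp, Real.exp_le_one_iff]
  simpa using mul_nonneg hz ht

/-- Abel's theorem for Laplace transforms. -/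
lemma tendsto_laplace {f : ℝ≥0 → ℂ} {θ : ℂ} (hf : LaplaceConverges f θ) :
    Tendsto (fun n : ℕ => laplace f (θ + ((1 / ((n : ℝ) + 1) : ℝ) : ℂ))) atTop
      (𝓝 (laplace f θ)) := by
  -- The shift only adds a factor of modulus at most `1` on `t ≥ 0`, so the integrand at `θ`
  -- dominates.
  have hmul : ∀ (n : ℕ) (t : ℝ), laplaceIntegrand f (θ + ((1 / ((n : ℝ) + 1) : ℝ) : ℂ)) t =
      Complex.exp (-((1 / ((n : ℝ) + 1) : ℝ) : ℂ) * t) * laplaceIntegrand f θ t := by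
    intro n t
    rw [laplaceIntegrand, laplaceIntegrand, ← mul_assoc, ← Complex.exp_add]
    congr 2
    ring
  have hf' : IntegrableOn (laplaceIntegrand f θ) (Ici 0) volume := hf
  refine tendsto_integral_of_dominated_convergence (fun t => ‖laplaceIntegrand f θ t‖)
    (fun n => ?_) hf'.norm (fun n => ?_) (Eventually.of_forall fun t => ?_)
  · rw [funext (hmul n)]
    exact (by fun_prop : Continuous fun t : ℝ =>
      Complex.exp (-((1 / ((n : ℝ) + 1) : ℝ) : ℂ) * t)).aestronglyMeasurable.mul
        hf'.aestronglyMeasurable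
  · filter_upwards [ae_restrict_mem measurableSet_Ici] with t ht
    rw [hmul, norm_mul]
    refine mul_le_of_le_one_left (norm_nonneg _) (norm_exp_neg_mul_le ?_ ht)
    rw [Complex.ofReal_re]
    positivity
  · refine Tendsto.mul_const _ ?_
    have hc : Continuous fun z : ℂ => Complex.exp (-z * t) := by fun_prop
    exact (hc.tendsto θ).comp (tendsto_add_one_div θ)

variable {Ω : Type*} [MeasurableSpace Ω] {P : Measure Ω}

lemma integral_map_exp_neg_mul {X : Ω → ℝ≥0} (hX : Measurable X) (z : ℂ) :
    ∫ a : ℝ≥0, Complex.exp (-z * ((a : ℝ) : ℂ)) ∂(P.map X) = lst P X z :=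
  integral_map hX.aemeasurable (by fun_prop)

variable [IsProbabilityMeasure P]

lemma integrable_exp_neg_mul {X : Ω → ℝ≥0} (hX : Measurable X) {z : ℂ} (hz : 0 ≤ z.re) :
    Integrable (fun ω => Complex.exp (-z * ((X ω : ℝ) : ℂ))) P :=
  .of_bound (by fun_prop) 1 (Eventually.of_forall fun ω => norm_exp_neg_mul_le hz (X ω).2)

lemma tendsto_lst {X : Ω → ℝ≥0} (hX : Measurable X) {z : ℂ} (hz : 0 ≤ z.re) :
    Tendsto (fun n : ℕ => lst P X (z + ((1 / ((n : ℝ) + 1) : ℝ) : ℂ))) atTop (𝓝 (lst P X z)) := by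
  refine tendsto_integral_of_dominated_convergence (fun _ => 1) (fun n => by fun_prop)
    (integrable_const _) (fun n => Eventually.of_forall fun ω => ?_)
    (Eventually.of_forall fun ω => ?_)
  · refine norm_exp_neg_mul_le ?_ (X ω).2
    rw [Complex.add_re, Complex.ofReal_re]
    positivity
  · have hc : Continuous fun z : ℂ => Complex.exp (-z * ((X ω : ℝ) : ℂ)) := by fun_prop
    exact (hc.tendsto z).comp (tendsto_add_one_div z)

section Mixture

variable {S : Type*} [MeasurableSpace S] {μ : Measure S} [IsProbabilityMeasure μ]
  {K : ℝ≥0 → S → ℂ}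

/-- The bound `exp (-(Re θ) t)` is integrable because `Re θ > 0`. This one fact yields both absolute
convergence and the exchange of integrals. -/
lemma integrable_laplace_mixture (hK : Measurable (Function.uncurry K)) (hK1 : ∀ t p, ‖K t p‖ ≤ 1)
    {θ : ℂ} (hθ : 0 < θ.re) :
    Integrable (fun q : ℝ × S => Complex.exp (-θ * (q.1 : ℂ)) * K q.1.toNNReal q.2)
      ((volume.restrict (Ici 0)).prod μ) := by
  have hb : Integrable (fun t : ℝ => Real.exp (-θ.re * t)) (volume.restrict (Ici 0)) :=
    (integrableOn_Ici_iff_integrableOn_Ioi).2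
      (integrableOn_exp_mul_Ioi (neg_lt_zero.2 hθ) 0)
  refine (hb.comp_fst μ).mono' ?_ (Eventually.of_forall fun q => ?_)
  · have h1 : Measurable fun q : ℝ × S => K q.1.toNNReal q.2 :=
      hK.comp (f := fun q : ℝ × S => (q.1.toNNReal, q.2)) (by fun_prop)
    exact ((by fun_prop : Measurable fun q : ℝ × S => Complex.exp (-θ * (q.1 : ℂ))).mul
      h1).aestronglyMeasurable
  · rw [norm_mul, Complex.norm_exp]
    refine (mul_le_of_le_one_right (by positivity) (hK1 _ _)).trans_eq ?_
    simp

lemma laplaceConverges_mixture (hK : Measurable (Function.uncurry K)) (hK1 : ∀ t p, ‖K t p‖ ≤ 1)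
    {θ : ℂ} (hθ : 0 < θ.re) : LaplaceConverges (fun t => ∫ p, K t p ∂μ) θ := by
  have := (integrable_laplace_mixture (μ := μ) hK hK1 hθ).integral_prod_left
  simp only [integral_const_mul] at this
  exact this

lemma laplace_mixture (hK : Measurable (Function.uncurry K)) (hK1 : ∀ t p, ‖K t p‖ ≤ 1)
    {θ : ℂ} (hθ : 0 < θ.re) :
    laplace (fun t => ∫ p, K t p ∂μ) θ = ∫ p, laplace (fun t => K t p) θ ∂μ := by
  have := integral_integral_swap
    (f := fun (t : ℝ) p => Complex.exp (-θ * (t : ℂ)) * K t.toNNReal p)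
    (integrable_laplace_mixture (μ := μ) hK hK1 hθ)
  simp only [integral_const_mul] at this
  exact this

end Mixture

lemma integral_Ico_exp_mul {a b : ℝ} (hab : a ≤ b) {c : ℂ} (hc : c ≠ 0) :
    ∫ t in Ico a b, Complex.exp (c * (t : ℂ)) =
      (Complex.exp (c * b) - Complex.exp (c * a)) / c := by
  rw [integral_Ico_eq_integral_Ioc, ← intervalIntegral.integral_of_le hab,
    integral_exp_mul_complex hc]

/-- The Laplace transform of an exponential function cut off to an interval. -/
lemma laplace_ite_exp {a b : ℝ≥0} (hab : a ≤ b) {c d θ : ℂ} (hc : θ + c ≠ 0) :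
    laplace (fun t => if a ≤ t ∧ t < b then Complex.exp (d - c * ((t : ℝ) : ℂ)) else 0) θ =
      Complex.exp d * (Complex.exp (-(θ + c) * a) - Complex.exp (-(θ + c) * b)) / (θ + c) := by
  have hsub : Ico (a : ℝ) b ⊆ Ici 0 := fun t ht => mem_Ici.2 ((NNReal.coe_nonneg a).trans ht.1)
  have h1 : ∀ t ∈ Ici (0 : ℝ), laplaceIntegrand
      (fun t => if a ≤ t ∧ t < b then Complex.exp (d - c * ((t : ℝ) : ℂ)) else 0) θ t =
      (Ico (a : ℝ) b).indicator (fun t => Complex.exp d * Complex.exp (-(θ + c) * (t : ℂ))) t := by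
    intro t ht
    lift t to ℝ≥0 using ht
    simp only [laplaceIntegrand, Real.toNNReal_coe, indicator_apply, mem_Ico, NNReal.coe_le_coe,
      NNReal.coe_lt_coe]
    split_ifs
    · rw [← Complex.exp_add, ← Complex.exp_add]
      congr 1
      ring
    · simp
  rw [laplace, setIntegral_congr_fun measurableSet_Ici h1, setIntegral_indicator measurableSet_Ico,
    inter_eq_right.2 hsub, integral_const_mul,
    integral_Ico_exp_mul (NNReal.coe_le_coe.2 hab) (neg_ne_zero.2 hc)]
  field_simp
  ring

end LaplaceTransforms

/-! ### Conditional expectations given the two random times -/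

section Kernels

/-- The exponential discount `exp (-w a - x b)` on the event described by `C`. -/
def discount (w x : ℂ) (C : ℝ≥0 × ℝ≥0 → Prop) [DecidablePred C] (p : ℝ≥0 × ℝ≥0) : ℂ :=
  if C p then Complex.exp (-w * ((p.1 : ℝ) : ℂ) - x * ((p.2 : ℝ) : ℂ)) else 0

lemma norm_discount_le {w x : ℂ} (hw : 0 ≤ w.re) (hx : 0 ≤ x.re) (C : ℝ≥0 × ℝ≥0 → Prop)
    [DecidablePred C] (p : ℝ≥0 × ℝ≥0) : ‖discount w x C p‖ ≤ 1 := by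
  unfold discount
  split_ifs
  · rw [sub_eq_add_neg, Complex.exp_add, ← neg_mul, norm_mul]
    exact mul_le_one₀ (norm_exp_neg_mul_le hw p.1.2) (norm_nonneg _)
      (norm_exp_neg_mul_le hx p.2.2)
  · simp

lemma measurable_discount (w x : ℂ) {C : ℝ≥0 × ℝ≥0 → Prop} [DecidablePred C]
    (hC : MeasurableSet {p | C p}) : Measurable (discount w x C) :=
  Measurable.ite hC (by fun_prop) measurable_const

/-- The conditional value of `F₁` given the pair of random times. -/
def kernel₁ (w x q₁ q₂ q₃ : ℂ) (t : ℝ≥0) (p : ℝ≥0 × ℝ≥0) : ℂ :=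
  -- The vacuous `0 ≤ t` gives the interval form required by `laplace_ite_exp`.
  if 0 ≤ t ∧ t < p.1 then
    Complex.exp ((-(w + q₂) * ((p.1 : ℝ) : ℂ) - (x + q₃) * ((p.2 : ℝ) : ℂ))
      - (q₁ - q₂) * ((t : ℝ) : ℂ))
  else 0

/-- The conditional value of `F₂` given the pair of random times. -/
def kernel₂ (w x q₁ q₂ q₃ : ℂ) (t : ℝ≥0) (p : ℝ≥0 × ℝ≥0) : ℂ :=
  if p.1 ≤ t ∧ t < p.1 + p.2 then
    Complex.exp ((-(w + q₁ - q₂ + q₃) * ((p.1 : ℝ) : ℂ) - (x + q₃) * ((p.2 : ℝ) : ℂ))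
      - (q₂ - q₃) * ((t : ℝ) : ℂ))
  else 0

lemma measurable_kernel₁ (w x q₁ q₂ q₃ : ℂ) :
    Measurable (Function.uncurry (kernel₁ w x q₁ q₂ q₃)) :=
  Measurable.ite ((measurableSet_le (by fun_prop) (by fun_prop)).inter
    (measurableSet_lt (by fun_prop) (by fun_prop))) (by fun_prop) measurable_const

lemma measurable_kernel₂ (w x q₁ q₂ q₃ : ℂ) :
    Measurable (Function.uncurry (kernel₂ w x q₁ q₂ q₃)) :=
  Measurable.ite ((measurableSet_le (by fun_prop) (by fun_prop)).inter
    (measurableSet_lt (by fun_prop) (by fun_prop))) (by fun_prop) measurable_const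

/-- At the upper endpoint `t = p.1` the terms in `q₂` cancel, leaving the rate `θ + w + q₁`. -/
lemma laplace_kernel₁ {w x q₁ q₂ q₃ θ : ℂ} (hc : θ + (q₁ - q₂) ≠ 0) (p : ℝ≥0 × ℝ≥0) :
    laplace (fun t => kernel₁ w x q₁ q₂ q₃ t p) θ =
      (Complex.exp (-(w + q₂) * ((p.1 : ℝ) : ℂ)) - Complex.exp (-(θ + w + q₁) * ((p.1 : ℝ) : ℂ))) /
        (θ + (q₁ - q₂)) * Complex.exp (-(x + q₃) * ((p.2 : ℝ) : ℂ)) := by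
  refine (laplace_ite_exp (zero_le : 0 ≤ p.1) hc).trans ?_
  rw [mul_div_right_comm, div_mul_eq_mul_div, div_mul_eq_mul_div, mul_sub, sub_mul,
    ← Complex.exp_add, ← Complex.exp_add, ← Complex.exp_add, ← Complex.exp_add]
  congr 3
  · push_cast
    ring
  · ring

/-- Both endpoints contain `p.1`, and there `q₂` and `q₃` cancel from its coefficient. The common
factor with rate `θ + w + q₁` thus splits off from the dependence on `p.2`. -/
lemma laplace_kernel₂ {w x q₁ q₂ q₃ θ : ℂ} (hc : θ + (q₂ - q₃) ≠ 0) (p : ℝ≥0 × ℝ≥0) :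
    laplace (fun t => kernel₂ w x q₁ q₂ q₃ t p) θ =
      Complex.exp (-(θ + w + q₁) * ((p.1 : ℝ) : ℂ)) *
        ((Complex.exp (-(x + q₃) * ((p.2 : ℝ) : ℂ)) -
          Complex.exp (-(θ + x + q₂) * ((p.2 : ℝ) : ℂ))) / (θ + (q₂ - q₃))) := by
  refine (laplace_ite_exp le_self_add hc).trans ?_
  rw [← mul_div_assoc, mul_sub, mul_sub,
    ← Complex.exp_add, ← Complex.exp_add, ← Complex.exp_add, ← Complex.exp_add]
  congr 3
  · ring
  · push_cast
    ring

variable {Ω : Type*} [mΩ : MeasurableSpace Ω] {P : Measure Ω} [IsProbabilityMeasure P]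
  {lam : ℝ≥0} {pt : ℕ → Ω → ℝ≥0} {mark : ℕ → Ω → ℕ}

/-- The exponent `lam (1 - g z)` of the compound Poisson process. -/
def exponent (P : Measure Ω) (lam : ℝ≥0) (mark : ℕ → Ω → ℕ) (z : ℂ) : ℂ :=
  lam * (1 - pgf P (mark 0) z)

/-- Keeps the arguments of the Laplace-Stieltjes transforms in the closed right half-plane, where
their integrands are bounded. -/
lemma exponent_re_nonneg (mark : ℕ → Ω → ℕ) {z : ℂ} (hz : ‖z‖ ≤ 1) :
    0 ≤ (exponent P lam mark z).re := by
  have h1 : (pgf P (mark 0) z).re ≤ 1 := (Complex.re_le_norm _).trans (norm_pgf_le _ hz)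
  have : (exponent P lam mark z).re = lam * (1 - (pgf P (mark 0) z).re) := by
    simp [exponent]
  rw [this]
  exact mul_nonneg lam.2 (sub_nonneg.2 h1)

section Freeze

variable {T Δ : Ω → ℝ≥0} {u v w x y : ℂ}

lemma norm_integral_frozen_le (hu : ‖u‖ ≤ 1) (hv : ‖v‖ ≤ 1) (hy : ‖y‖ ≤ 1) {d : ℂ} (hd : ‖d‖ ≤ 1)
    (m₁ m₂ m₃ : Ω → ℕ) : ‖∫ ω, d * u ^ m₁ ω * v ^ m₂ ω * y ^ m₃ ω ∂P‖ ≤ 1 := by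
  simpa using norm_integral_le_of_norm_le_const (μ := P) (Eventually.of_forall fun ω =>
    norm_pow_mul_le hy (norm_pow_mul_le hv (norm_pow_mul_le hu hd (m₁ ω)) (m₂ ω)) (m₃ ω))

lemma integral_frozen₁ (h : IsMarkedPoisson P lam pt mark) (hu : ‖u‖ ≤ 1) (hv : ‖v‖ ≤ 1)
    (hy : ‖y‖ ≤ 1) (t : ℝ≥0) (p : ℝ≥0 × ℝ≥0) :
    ∫ ω, discount w x (fun p => t < p.1) p * u ^ process pt mark p.1 ω *
        v ^ process pt mark (p.1 + p.2) ω * y ^ process pt mark t ω ∂P =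
      kernel₁ w x (exponent P lam mark (u * v * y)) (exponent P lam mark (u * v))
        (exponent P lam mark v) t p := by
  unfold discount kernel₁
  simp only [zero_le, true_and]
  split_ifs with ht
  -- Here `t` is the earliest time, so `y` comes first.
  · have := h.integral_pow_process ht.le (le_self_add (b := p.2)) hy hu hv
    rw [show y * u * v = u * v * y by ring] at this
    trans Complex.exp (-w * ((p.1 : ℝ) : ℂ) - x * ((p.2 : ℝ) : ℂ)) *
      ∫ ω, y ^ process pt mark t ω * u ^ process pt mark p.1 ω *
        v ^ process pt mark (p.1 + p.2) ω ∂P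
    · rw [← integral_const_mul]
      exact integral_congr_ae (Eventually.of_forall fun ω => by ring)
    · rw [this, ← Complex.exp_add]
      congr 1
      unfold exponent
      push_cast
      ring
  · simp

lemma integral_frozen₂ (h : IsMarkedPoisson P lam pt mark) (hu : ‖u‖ ≤ 1) (hv : ‖v‖ ≤ 1)
    (hy : ‖y‖ ≤ 1) (t : ℝ≥0) (p : ℝ≥0 × ℝ≥0) :
    ∫ ω, discount w x (fun p => p.1 ≤ t ∧ t < p.1 + p.2) p * u ^ process pt mark p.1 ω *
        v ^ process pt mark (p.1 + p.2) ω * y ^ process pt mark t ω ∂P =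
      kernel₂ w x (exponent P lam mark (u * v * y)) (exponent P lam mark (v * y))
        (exponent P lam mark v) t p := by
  unfold discount kernel₂
  split_ifs with ht
  · have := h.integral_pow_process ht.1 ht.2.le hu hy hv
    rw [mul_right_comm u y v, mul_comm y v] at this
    trans Complex.exp (-w * ((p.1 : ℝ) : ℂ) - x * ((p.2 : ℝ) : ℂ)) *
      ∫ ω, u ^ process pt mark p.1 ω * y ^ process pt mark t ω *
        v ^ process pt mark (p.1 + p.2) ω ∂P
    · rw [← integral_const_mul]
      exact integral_congr_ae (Eventually.of_forall fun ω => by ring)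
    · rw [this, ← Complex.exp_add]
      congr 1
      unfold exponent
      push_cast
      ring
  · simp

/-- The explicit formula hides this bound, as `q₁ - q₂` may have negative real part; it holds
because the kernel is an expectation of variables of modulus at most `1`. -/
lemma norm_kernel₁_le (h : IsMarkedPoisson P lam pt mark) (hu : ‖u‖ ≤ 1) (hv : ‖v‖ ≤ 1)
    (hy : ‖y‖ ≤ 1) (hw : 0 ≤ w.re) (hx : 0 ≤ x.re) (t : ℝ≥0) (p : ℝ≥0 × ℝ≥0) :
    ‖kernel₁ w x (exponent P lam mark (u * v * y)) (exponent P lam mark (u * v))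
      (exponent P lam mark v) t p‖ ≤ 1 := by
  rw [← integral_frozen₁ h hu hv hy]
  exact norm_integral_frozen_le hu hv hy (norm_discount_le hw hx _ _) _ _ _

lemma norm_kernel₂_le (h : IsMarkedPoisson P lam pt mark) (hu : ‖u‖ ≤ 1) (hv : ‖v‖ ≤ 1)
    (hy : ‖y‖ ≤ 1) (hw : 0 ≤ w.re) (hx : 0 ≤ x.re) (t : ℝ≥0) (p : ℝ≥0 × ℝ≥0) :
    ‖kernel₂ w x (exponent P lam mark (u * v * y)) (exponent P lam mark (v * y))
      (exponent P lam mark v) t p‖ ≤ 1 := by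
  rw [← integral_frozen₂ h hu hv hy]
  exact norm_integral_frozen_le hu hv hy (norm_discount_le hw hx _ _) _ _ _

lemma F₁_eq_mixture (h : IsMarkedPoisson P lam pt mark) (ℱ : Filtration ℝ≥0 mΩ)
    (hadapted : Adapted ℱ (process pt mark)) (hT : Measurable T) (hΔ : Measurable Δ)
    (hTΔℱ : Indep (MeasurableSpace.comap (fun ω => (T ω, Δ ω)) inferInstance) (⨆ t, ℱ t) P)
    (hu : ‖u‖ ≤ 1) (hv : ‖v‖ ≤ 1) (hy : ‖y‖ ≤ 1) (hw : 0 ≤ w.re) (hx : 0 ≤ x.re) :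
    F₁ P (process pt mark) T Δ u v w x y = fun t => ∫ p,
      kernel₁ w x (exponent P lam mark (u * v * y)) (exponent P lam mark (u * v))
        (exponent P lam mark v) t p ∂(P.map fun ω => (T ω, Δ ω)) := by
  funext t
  have := integral_process_random_times h.isPoissonPoints ℱ hadapted hT hΔ hTΔℱ hu hv hy t
    (measurable_discount w x (C := fun p => t < p.1)
      (measurableSet_lt (by fun_prop) (by fun_prop))) (norm_discount_le hw hx _)
  simp only [integral_frozen₁ h hu hv hy] at this
  rw [← this]
  refine integral_congr_ae (Eventually.of_forall fun ω => ?_)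
  simp only [indicator_apply, mem_ofPred_eq, discount]
  split_ifs <;> ring

lemma F₂_eq_mixture (h : IsMarkedPoisson P lam pt mark) (ℱ : Filtration ℝ≥0 mΩ)
    (hadapted : Adapted ℱ (process pt mark)) (hT : Measurable T) (hΔ : Measurable Δ)
    (hTΔℱ : Indep (MeasurableSpace.comap (fun ω => (T ω, Δ ω)) inferInstance) (⨆ t, ℱ t) P)
    (hu : ‖u‖ ≤ 1) (hv : ‖v‖ ≤ 1) (hy : ‖y‖ ≤ 1) (hw : 0 ≤ w.re) (hx : 0 ≤ x.re) :
    F₂ P (process pt mark) T Δ u v w x y = fun t => ∫ p,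
      kernel₂ w x (exponent P lam mark (u * v * y)) (exponent P lam mark (v * y))
        (exponent P lam mark v) t p ∂(P.map fun ω => (T ω, Δ ω)) := by
  funext t
  have := integral_process_random_times h.isPoissonPoints ℱ hadapted hT hΔ hTΔℱ hu hv hy t
    (measurable_discount w x (C := fun p => p.1 ≤ t ∧ t < p.1 + p.2)
      ((measurableSet_le (by fun_prop) (by fun_prop)).inter
        (measurableSet_lt (by fun_prop) (by fun_prop)))) (norm_discount_le hw hx _)
  simp only [integral_frozen₂ h hu hv hy] at this
  rw [← this]
  refine integral_congr_ae (Eventually.of_forall fun ω => ?_)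
  simp only [indicator_apply, mem_ofPred_eq, discount]
  split_ifs <;> ring

end Freeze

lemma integral_map_prodMk_mul {T Δ : Ω → ℝ≥0} (hT : Measurable T) (hΔ : Measurable Δ)
    (hTΔ : IndepFun T Δ P) (f k : ℝ≥0 → ℂ) :
    ∫ p : ℝ≥0 × ℝ≥0, f p.1 * k p.2 ∂(P.map fun ω => (T ω, Δ ω)) =
      (∫ a, f a ∂(P.map T)) * ∫ b, k b ∂(P.map Δ) := by
  have := Measure.isProbabilityMeasure_map (μ := P) hT.aemeasurable
  have := Measure.isProbabilityMeasure_map (μ := P) hΔ.aemeasurable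
  rw [(indepFun_iff_map_prod_eq_prod_map_map hT.aemeasurable hΔ.aemeasurable).1 hTΔ,
    integral_prod_mul]

lemma integral_map_sub_exp_div {X : Ω → ℝ≥0} (hX : Measurable X) {z₁ z₂ c : ℂ} (h₁ : 0 ≤ z₁.re)
    (h₂ : 0 ≤ z₂.re) :
    ∫ a : ℝ≥0, (Complex.exp (-z₁ * ((a : ℝ) : ℂ)) - Complex.exp (-z₂ * ((a : ℝ) : ℂ))) / c
      ∂(P.map X) = (lst P X z₁ - lst P X z₂) / c := by
  have := Measure.isProbabilityMeasure_map (μ := P) hX.aemeasurable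
  have hint : ∀ {z : ℂ}, 0 ≤ z.re →
      Integrable (fun a : ℝ≥0 => Complex.exp (-z * ((a : ℝ) : ℂ))) (P.map X) :=
    fun hz => integrable_exp_neg_mul measurable_id hz
  rw [integral_div, integral_sub (hint h₁) (hint h₂), integral_map_exp_neg_mul hX,
    integral_map_exp_neg_mul hX]

end Kernels

/-! ### Averaging over the random times and extension to the boundary -/

section Formulas

variable {Ω : Type*} [mΩ : MeasurableSpace Ω] {P : Measure Ω} [IsProbabilityMeasure P]
  {T Δ : Ω → ℝ≥0}

lemma laplace_mixture_kernel₁ (hT : Measurable T) (hΔ : Measurable Δ) (hTΔ : IndepFun T Δ P)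
    {w x q₁ q₂ q₃ θ : ℂ} (hK : ∀ t p, ‖kernel₁ w x q₁ q₂ q₃ t p‖ ≤ 1) (h₁ : 0 ≤ (w + q₁).re)
    (h₂ : 0 ≤ (w + q₂).re) (hθ : 0 < θ.re) (hc : θ + (q₁ - q₂) ≠ 0) :
    laplace (fun t => ∫ p, kernel₁ w x q₁ q₂ q₃ t p ∂(P.map fun ω => (T ω, Δ ω))) θ =
      (lst P T (w + q₂) - lst P T (θ + w + q₁)) / (θ + (q₁ - q₂)) * lst P Δ (x + q₃) := by
  have := Measure.isProbabilityMeasure_map (μ := P) (hT.prodMk hΔ).aemeasurable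
  rw [laplace_mixture (measurable_kernel₁ w x q₁ q₂ q₃) hK hθ]
  simp_rw [laplace_kernel₁ hc]
  rw [integral_map_prodMk_mul hT hΔ hTΔ
    (fun a => (Complex.exp (-(w + q₂) * ((a : ℝ) : ℂ)) -
      Complex.exp (-(θ + w + q₁) * ((a : ℝ) : ℂ))) / (θ + (q₁ - q₂)))
    (fun b => Complex.exp (-(x + q₃) * ((b : ℝ) : ℂ))), integral_map_exp_neg_mul hΔ,
    integral_map_sub_exp_div hT h₂]
  rw [add_assoc, Complex.add_re]
  exact add_nonneg hθ.le h₁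

lemma laplace_mixture_kernel₂ (hT : Measurable T) (hΔ : Measurable Δ) (hTΔ : IndepFun T Δ P)
    {w x q₁ q₂ q₃ θ : ℂ} (hK : ∀ t p, ‖kernel₂ w x q₁ q₂ q₃ t p‖ ≤ 1) (h₂ : 0 ≤ (x + q₂).re)
    (h₃ : 0 ≤ (x + q₃).re) (hθ : 0 < θ.re) (hc : θ + (q₂ - q₃) ≠ 0) :
    laplace (fun t => ∫ p, kernel₂ w x q₁ q₂ q₃ t p ∂(P.map fun ω => (T ω, Δ ω))) θ =
      lst P T (θ + w + q₁) * ((lst P Δ (x + q₃) - lst P Δ (θ + x + q₂)) / (θ + (q₂ - q₃))) := by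
  have := Measure.isProbabilityMeasure_map (μ := P) (hT.prodMk hΔ).aemeasurable
  rw [laplace_mixture (measurable_kernel₂ w x q₁ q₂ q₃) hK hθ]
  simp_rw [laplace_kernel₂ hc]
  rw [integral_map_prodMk_mul hT hΔ hTΔ
    (fun a => Complex.exp (-(θ + w + q₁) * ((a : ℝ) : ℂ)))
    (fun b => (Complex.exp (-(x + q₃) * ((b : ℝ) : ℂ)) -
      Complex.exp (-(θ + x + q₂) * ((b : ℝ) : ℂ))) / (θ + (q₂ - q₃))),
    integral_map_exp_neg_mul hT, integral_map_sub_exp_div hΔ h₃]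
  rw [add_assoc, Complex.add_re]
  exact add_nonneg hθ.le h₂

/-- An identity for a Laplace transform on the open right half-plane extends to those boundary
points where the transform converges absolutely and the other side is continuous. -/
lemma laplace_eq_of_tendsto {f : ℝ≥0 → ℂ} {R : ℂ → ℂ} {c θ : ℂ} (hθ : 0 ≤ θ.re)
    (hf : LaplaceConverges f θ) (hc : θ + c ≠ 0)
    (hR : ∀ s : ℂ, 0 < s.re → s + c ≠ 0 → laplace f s = R s)
    (hlim : Tendsto (fun n : ℕ => R (θ + ((1 / ((n : ℝ) + 1) : ℝ) : ℂ))) atTop (𝓝 (R θ))) :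
    laplace f θ = R θ := by
  refine tendsto_nhds_unique (tendsto_laplace hf) (hlim.congr' ?_)
  -- The denominator is nonzero at `θ`, hence at all nearby shifted points.
  filter_upwards [((tendsto_add_one_div θ).add_const c).eventually_ne hc] with n hn
  refine (hR _ ?_ hn).symm
  rw [Complex.add_re, Complex.ofReal_re]
  positivity

lemma tendsto_lst_add {X : Ω → ℝ≥0} (hX : Measurable X) {θ z q : ℂ} (hθ : 0 ≤ θ.re)
    (hz : 0 ≤ (z + q).re) :
    Tendsto (fun n : ℕ => lst P X (θ + ((1 / ((n : ℝ) + 1) : ℝ) : ℂ) + z + q)) atTop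
      (𝓝 (lst P X (θ + z + q))) := by
  have h : 0 ≤ (θ + z + q).re := by
    rw [add_assoc, Complex.add_re]
    exact add_nonneg hθ hz
  refine (tendsto_lst (P := P) hX h).congr fun n => ?_
  congr 1
  ring

end Formulas

end MarkedPoisson

end

open MarkedPoisson Filter Topology in
theorem mainTheorem6 {Ω : Type*} [mΩ : MeasurableSpace Ω] (P : Measure Ω)
    [IsProbabilityMeasure P] (lam : ℝ≥0) (hlam : 0 < lam)
    (pt : ℕ → Ω → ℝ≥0) (mark : ℕ → Ω → ℕ)
    (hmp : MarkedPoisson.IsMarkedPoisson P lam pt mark)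
    (A : ℝ≥0 → Ω → ℕ) (hA : A = MarkedPoisson.process pt mark)
    (ℱ : Filtration ℝ≥0 mΩ) (hadapted : Adapted ℱ A)
    (T Δ : Ω → ℝ≥0) (hT : Measurable T) (hΔ : Measurable Δ)
    (hTΔ : IndepFun T Δ P)
    (hTΔℱ : Indep (MeasurableSpace.comap (fun ω => (T ω, Δ ω)) inferInstance) (⨆ t, ℱ t) P)
    (g : ℂ → ℂ) (hg : g = MarkedPoisson.pgf P (mark 0))
    (u v w x y θ : ℂ) (hu : ‖u‖ ≤ 1) (hv : ‖v‖ ≤ 1) (hy : ‖y‖ ≤ 1)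
    (hw : 0 ≤ w.re) (hx : 0 ≤ x.re) (hθ : 0 ≤ θ.re) :
    (0 < θ.re →
      MarkedPoisson.LaplaceConverges (MarkedPoisson.F₁ P A T Δ u v w x y) θ ∧
      MarkedPoisson.LaplaceConverges (MarkedPoisson.F₂ P A T Δ u v w x y) θ) ∧
    (MarkedPoisson.LaplaceConverges (MarkedPoisson.F₁ P A T Δ u v w x y) θ →
      θ + lam * g (u * v) - lam * g (u * v * y) ≠ 0 →
      MarkedPoisson.laplace (MarkedPoisson.F₁ P A T Δ u v w x y) θ =
        (MarkedPoisson.lst P T (w + lam - lam * g (u * v)) -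
            MarkedPoisson.lst P T (θ + w + lam - lam * g (u * v * y))) /
          (θ + lam * g (u * v) - lam * g (u * v * y)) *
        MarkedPoisson.lst P Δ (x + lam - lam * g v)) ∧
    (MarkedPoisson.LaplaceConverges (MarkedPoisson.F₂ P A T Δ u v w x y) θ →
      θ + lam * g v - lam * g (v * y) ≠ 0 →
      MarkedPoisson.laplace (MarkedPoisson.F₂ P A T Δ u v w x y) θ =
        MarkedPoisson.lst P T (θ + w + lam - lam * g (u * v * y)) *
          ((MarkedPoisson.lst P Δ (x + lam - lam * g v) -
              MarkedPoisson.lst P Δ (θ + x + lam - lam * g (v * y))) /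
            (θ + lam * g v - lam * g (v * y)))) := by
  subst hA hg
  have h₁ : 0 ≤ (exponent P lam mark (u * v * y)).re := exponent_re_nonneg mark
    (by rw [norm_mul, norm_mul]; exact mul_le_one₀ (mul_le_one₀ hu (norm_nonneg _) hv)
          (norm_nonneg _) hy)
  have h₂ : 0 ≤ (exponent P lam mark (u * v)).re := exponent_re_nonneg mark
    (by rw [norm_mul]; exact mul_le_one₀ hu (norm_nonneg _) hv)
  have h₃ : 0 ≤ (exponent P lam mark v).re := exponent_re_nonneg mark hv
  have h₄ : 0 ≤ (exponent P lam mark (v * y)).re := exponent_re_nonneg mark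
    (by rw [norm_mul]; exact mul_le_one₀ hv (norm_nonneg _) hy)
  have hadd : ∀ {a b : ℂ}, 0 ≤ a.re → 0 ≤ b.re → 0 ≤ (a + b).re := fun ha hb => by
    rw [Complex.add_re]; exact add_nonneg ha hb
  -- Rewriting in terms of `exponent` puts the arguments and denominators into the form produced by
  -- the kernels.
  have e : ∀ s z : ℂ, s + lam - lam * pgf P (mark 0) z = s + exponent P lam mark z := by
    intro s z
    unfold exponent
    ring
  have ec : ∀ s a b : ℂ, s + lam * pgf P (mark 0) a - lam * pgf P (mark 0) b =
      s + (exponent P lam mark b - exponent P lam mark a) := by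
    intro s a b
    unfold exponent
    ring
  have hK₁ := norm_kernel₁_le hmp hu hv hy hw hx
  have hK₂ := norm_kernel₂_le hmp hu hv hy hw hx
  have := Measure.isProbabilityMeasure_map (μ := P) (hT.prodMk hΔ).aemeasurable
  simp only [e, ec, F₁_eq_mixture hmp ℱ hadapted hT hΔ hTΔℱ hu hv hy hw hx,
    F₂_eq_mixture hmp ℱ hadapted hT hΔ hTΔℱ hu hv hy hw hx]
  refine ⟨fun hθ' => ⟨laplaceConverges_mixture (measurable_kernel₁ _ _ _ _ _) hK₁ hθ',
    laplaceConverges_mixture (measurable_kernel₂ _ _ _ _ _) hK₂ hθ'⟩, fun hf hc => ?_,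
    fun hf hc => ?_⟩
  · refine laplace_eq_of_tendsto (R := fun s =>
      (lst P T (w + exponent P lam mark (u * v)) -
        lst P T (s + w + exponent P lam mark (u * v * y))) /
          (s + (exponent P lam mark (u * v * y) - exponent P lam mark (u * v))) *
        lst P Δ (x + exponent P lam mark v)) hθ hf hc (fun s hs hsc =>
      laplace_mixture_kernel₁ hT hΔ hTΔ hK₁ (hadd hw h₁) (hadd hw h₂) hs hsc) ?_
    exact (((tendsto_lst_add hT hθ (hadd hw h₁)).const_sub _).div
      ((tendsto_add_one_div θ).add_const _) hc).mul_const _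
  · refine laplace_eq_of_tendsto (R := fun s =>
      lst P T (s + w + exponent P lam mark (u * v * y)) *
        ((lst P Δ (x + exponent P lam mark v) -
          lst P Δ (s + x + exponent P lam mark (v * y))) /
          (s + (exponent P lam mark (v * y) - exponent P lam mark v)))) hθ hf hc (fun s hs hsc =>
      laplace_mixture_kernel₂ hT hΔ hTΔ hK₂ (hadd hx h₄) (hadd hx h₃) hs hsc) ?_
    exact (tendsto_lst_add hT hθ (hadd hw h₁)).mul
      (((tendsto_lst_add hΔ hθ (hadd hx h₄)).const_sub _).div
        ((tendsto_add_one_div θ).add_const _) hc)
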